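/- For a finite $p$-group $H$ write $|H|=p^{n}$, $|H'|=p^{k}$ (where $H'$ is the derived subgroup), let $d=d(H)$ be the minimal number of generators of $H$, and let $\mathcal{M}(H)$ be its Schur multiplier, that is, $\mathcal{M}(H)=(R\cap F')/[R,F]$ for a free presentation $H\cong F/R$. Say that $|\mathcal{M}(H)|$ attains the bound if $$|\mathcal{M}(H)|=p^{\frac12(d-1)(n+k-2)+1},$$ where $n,k,d$ are the invariants of $H$ itself. Denote the lower central series by $\gamma_1(G)=G$, $\gamma_{i+1}(G)=[\gamma_i(G),G]$. Let $p$ be a prime and let $G$ be a (necessarily non-abelian) finite $p$-group of nilpotency class $t\ge 3$ such that $|\mathcal{M}(G)|$ attains the bound. Then $|\mathcal{M}(G/\gamma_i(G))|$ attains the bound for every $i$ with $3\le i\le t$. -/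

import Mathlib

/-- The relation subgroup `R` of the canonical free presentation `G ≅ F / R`, where `F` is the
free group on the underlying set of `G` and `F → G` sends each generator to itself. -/
def relationSubgroup (G : Type*) [Group G] : Subgroup (FreeGroup G) :=
  (FreeGroup.lift (id : G → G)).ker

instance relationSubgroup_normal (G : Type*) [Group G] : (relationSubgroup G).Normal :=
  MonoidHom.normal_ker _

/-- The subgroup `R ∩ F'` of the free group `F`. -/
def hopfNumerator (G : Type*) [Group G] : Subgroup (FreeGroup G) :=
  relationSubgroup G ⊓ commutator (FreeGroup G)

/-- The subgroup `[R, F]` of the free group `F`. -/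
def hopfDenominator (G : Type*) [Group G] : Subgroup (FreeGroup G) :=
  ⁅relationSubgroup G, (⊤ : Subgroup (FreeGroup G))⁆

instance hopfDenominator_normal (G : Type*) [Group G] : (hopfDenominator G).Normal := by
  unfold hopfDenominator
  infer_instance

theorem hopfDenominator_le_hopfNumerator (G : Type*) [Group G] :
    hopfDenominator G ≤ hopfNumerator G :=
  le_inf (Subgroup.commutator_le_left _ _) (Subgroup.commutator_mono le_top le_rfl)

/-- The Schur multiplier `M(G) = (R ∩ F') / [R, F]`. -/
abbrev SchurMultiplier (G : Type*) [Group G] : Type _ :=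
  hopfNumerator G ⧸ (hopfDenominator G).subgroupOf (hopfNumerator G)

/-- The `i`-th term `γ_i(G)` of the lower central series, indexed so that
`γ_1(G) = G` and `γ_{i+1}(G) = [γ_i(G), G]` for `i ≥ 1`. -/
abbrev gammaSubgroup (G : Type*) [Group G] (i : ℕ) : Subgroup G :=
  (⊤ : Subgroup G).lowerCentralSeries (i - 1)

/-- `|M(G)|` attains the bound: if `|G| = p ^ n`, `|G'| = p ^ k` and `d = d(G)` is the minimal
number of generators, then `|M(G)| = p ^ ((d - 1) (n + k - 2) / 2 + 1)`.
The exponent is a real number, as it may be a half-integer. -/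
def AttainsBound (p : ℕ) (G : Type*) [Group G] [Finite G] : Prop :=
  ∃ n k : ℕ, Nat.card G = p ^ n ∧ Nat.card (commutator G) = p ^ k ∧
    (Nat.card (SchurMultiplier G) : ℝ) =
      (p : ℝ) ^ ((1 / 2 : ℝ) * ((Group.rank G : ℝ) - 1) * ((n : ℝ) + (k : ℝ) - 2) + 1)

/-!
The proof compares Schur multipliers through central extensions. For `G ≅ F / R` the group
`E = F / [R, F]` is a central extension of `G` whose kernel meets `E'` in `M(G)`, and it maps to
every other central extension of `G`; hence `|Z ∩ P'| ≤ |M(G)|` for every central extension `P` of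
`G` with kernel `Z` (`card_ker_inf_commutator_le`).

Let `K ≤ G'` be normal in `G` and `d = d(G)`. If `K` is central with preimage `S` in `E`, then
`E / [S, E]` is a central extension of `G / K`, and this gives `|M(G)| |K| ≤ |M(G / K)| |[S, E]|`.
As commutation with `S` is bilinear, `|[S, E]| ≤ |K| ^ d`. Iteration along a central series gives
`|M(G)| ≤ |M(G / K)| |K| ^ (d - 1)` for all `K`
(`IsPGroup.card_schurMultiplier_mul_card_ker_le_pow`). The bound of the theorem changes by exactly
the factor `|K| ^ (d - 1)` between `G` and `G / K`, if `d` is used for both groups. So when `G`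
attains its bound, `|M(G / K)|` is at least the bound of `G / K` computed with `d` in place of
`d(G / K) ≤ d`.

The quotient `G / γ_i(G)` with `3 ≤ i ≤ t` is not abelian, and for non-abelian `p`-groups the bound
holds as an upper bound (`IsPGroup.sq_card_schurMultiplier_le_of_card_commutator`). The comparison
above, with `|K| = p`, reduces this to `|G'| = p`. There `[S, E]` has order at most `p ^ 2`, since
the lifts of two non-commuting elements generate `E` together with the centralizer of `S`, and what
remains is the bound `|M(A)| ^ 2 ≤ |A| ^ (d(A) - 1)` for the abelian group `A = G / G'`. For a
direct product of cyclic groups of orders `o i` the multiplier is generated by one element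
for each pair `i < j`, whose order is at most `min (o i) (o j)`, and the squares of these minima
multiply to at most `|A| ^ (d(A) - 1)`.
-/

section

open Subgroup
open scoped commutatorElement

/-! ### Central extensions -/

section CentralExtension

variable {P A : Type*} [Group P] [Group A]

theorem commutatorElement_eq_of_map_eq {f : P →* A} (hf : f.ker ≤ center P) {a a' b b' : P}
    (ha : f a = f a') (hb : f b = f b') : ⁅a, b⁆ = ⁅a', b'⁆ := by
  obtain ⟨z, hz, rfl⟩ : ∃ z ∈ center P, a = a' * z :=
    ⟨a'⁻¹ * a, hf (by simp [MonoidHom.mem_ker, ha]), by group⟩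
  obtain ⟨w, hw, rfl⟩ : ∃ w ∈ center P, b = b' * w :=
    ⟨b'⁻¹ * b, hf (by simp [MonoidHom.mem_ker, hb]), by group⟩
  have hz' := mem_center_iff.mp hz
  have hw' := mem_center_iff.mp hw
  simp only [commutatorElement_def, mul_inv_rev]
  calc a' * z * (b' * w) * (z⁻¹ * a'⁻¹) * (w⁻¹ * b'⁻¹)
      = a' * (z * (b' * w)) * z⁻¹ * a'⁻¹ * w⁻¹ * b'⁻¹ := by group
    _ = a' * b' * (w * a'⁻¹) * w⁻¹ * b'⁻¹ := by rw [← hz']; group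
    _ = _ := by rw [← hw']; group

theorem finite_commutator_of_ker_le_center [Finite A] {f : P →* A} (hf : f.ker ≤ center P) :
    Finite (commutator P) := by
  have : Finite (commutatorSet P) := by
    refine Set.Finite.subset (Set.finite_range
      fun q : f.range × f.range ↦ ⁅q.1.2.choose, q.2.2.choose⁆) ?_
    rintro _ ⟨a, b, rfl⟩
    exact ⟨(⟨f a, a, rfl⟩, ⟨f b, b, rfl⟩), commutatorElement_eq_of_map_eq hf
      (Exists.choose_spec (⟨a, rfl⟩ : ∃ x, f x = f a))
      (Exists.choose_spec (⟨b, rfl⟩ : ∃ x, f x = f b))⟩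
  infer_instance

end CentralExtension

theorem Nat.card_subgroup_map_le {G H : Type*} [Group G] [Group H] (f : G →* H) (K : Subgroup G)
    [Finite K] : Nat.card (K.map f) ≤ Nat.card K :=
  Nat.card_le_card_of_surjective _ (f.subgroupMap_surjective K)

/-- The covering group `F / [R, F]` of the canonical free presentation `G ≅ F / R`. -/
abbrev FreeCentralExtension (G : Type*) [Group G] : Type _ :=
  FreeGroup G ⧸ hopfDenominator G

namespace FreeCentralExtension

variable (G : Type*) [Group G]

/-- The projection `F / [R, F] → F / R ≅ G`. -/
def proj : FreeCentralExtension G →* G :=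
  QuotientGroup.lift (hopfDenominator G) (FreeGroup.lift (id : G → G))
    ((hopfDenominator_le_hopfNumerator G).trans inf_le_left)

theorem proj_surjective : Function.Surjective (proj G) := fun g ↦
  ⟨QuotientGroup.mk (FreeGroup.of g), by
    change FreeGroup.lift id (FreeGroup.of g) = g
    simp⟩

theorem ker_proj : (proj G).ker = (relationSubgroup G).map (QuotientGroup.mk' _) := by
  rw [proj, QuotientGroup.ker_lift]; rfl

theorem ker_proj_le_center : (proj G).ker ≤ center (FreeCentralExtension G) := by
  rw [ker_proj]
  rintro _ ⟨r, hr, rfl⟩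
  rw [mem_center_iff]
  intro g
  obtain ⟨g, rfl⟩ := QuotientGroup.mk'_surjective _ g
  rw [eq_comm, ← commutatorElement_eq_one_iff_mul_comm, ← map_commutatorElement]
  exact (QuotientGroup.eq_one_iff _).mpr (commutator_mem_commutator hr (mem_top g))

theorem card_schurMultiplier : Nat.card (SchurMultiplier G) =
    Nat.card ((proj G).ker ⊓ commutator (FreeCentralExtension G) : Subgroup _) := by
  have h : (hopfNumerator G).map (QuotientGroup.mk' (hopfDenominator G)) =
      (proj G).ker ⊓ commutator (FreeCentralExtension G) := by
    rw [ker_proj]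
    have hc : commutator (FreeCentralExtension G) =
        (commutator (FreeGroup G)).map (QuotientGroup.mk' (hopfDenominator G)) := by
      rw [commutator_def, commutator_def, map_commutator,
        map_top_of_surjective _ (QuotientGroup.mk'_surjective _)]
    rw [hc]
    refine le_antisymm (map_inf_le _ _ _) ?_
    rintro _ ⟨⟨r, hr, rfl⟩, c, hc, hrc⟩
    refine ⟨c, ⟨?_, hc⟩, hrc⟩
    have h1 : r⁻¹ * c ∈ hopfDenominator G := QuotientGroup.eq.mp hrc.symm
    have h2 := mul_mem hr (((hopfDenominator_le_hopfNumerator G).trans inf_le_left) h1)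
    simpa using h2
  rw [← h, ← relIndex_ker, QuotientGroup.ker_mk']
  rfl

end FreeCentralExtension

/-- The Schur multiplier dominates the central extensions: if `P → A` is a surjection with central
kernel `Z`, it is covered by `F / [R, F] → A` through a homomorphism that carries the derived
subgroup onto `P'`, so `Z ∩ P'` is an image of the Schur multiplier of `A`. -/
theorem card_ker_inf_commutator_le {P A : Type*} [Group P] [Group A] [Finite A] {f : P →* A}
    (hf : Function.Surjective f) (hker : f.ker ≤ center P) :
    Nat.card (f.ker ⊓ commutator P : Subgroup P) ≤ Nat.card (SchurMultiplier A) := by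
  let φ : FreeGroup A →* P := FreeGroup.lift (Function.surjInv hf)
  have hφ : f.comp φ = FreeGroup.lift id := by
    ext a
    simp [φ, Function.surjInv_eq hf]
  have hden : hopfDenominator A ≤ φ.ker := by
    refine commutator_le.mpr fun r hr x _ ↦ ?_
    have hr' : φ r ∈ f.ker := by
      rw [MonoidHom.mem_ker, ← MonoidHom.comp_apply, hφ]; exact hr
    rw [MonoidHom.mem_ker, map_commutatorElement, commutatorElement_eq_one_iff_mul_comm]
    exact (mem_center_iff.mp (hker hr') _).symm
  let ψ : FreeCentralExtension A →* P := QuotientGroup.lift _ φ hden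
  have hψ : ∀ e, f (ψ e) = FreeCentralExtension.proj A e := by
    intro e
    obtain ⟨e, rfl⟩ := QuotientGroup.mk'_surjective _ e
    exact DFunLike.congr_fun hφ e
  have hcomm : commutator P ≤ (commutator (FreeCentralExtension A)).map ψ := by
    refine commutator_le.mpr fun a _ b _ ↦ ?_
    obtain ⟨a', ha'⟩ := FreeCentralExtension.proj_surjective A (f a)
    obtain ⟨b', hb'⟩ := FreeCentralExtension.proj_surjective A (f b)
    rw [commutatorElement_eq_of_map_eq hker (a := a) (a' := ψ a') (b := b) (b' := ψ b')
      (by rw [hψ, ha']) (by rw [hψ, hb']), ← map_commutatorElement]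
    exact mem_map_of_mem _ (commutator_mem_commutator (mem_top _) (mem_top _))
  have := finite_commutator_of_ker_le_center (FreeCentralExtension.ker_proj_le_center A)
  have : Finite ((FreeCentralExtension.proj A).ker ⊓ commutator (FreeCentralExtension A) :
    Subgroup _) := Finite.of_injective _ (inclusion_injective inf_le_right)
  rw [FreeCentralExtension.card_schurMultiplier]
  have hle : f.ker ⊓ commutator P ≤ ((FreeCentralExtension.proj A).ker ⊓
      commutator (FreeCentralExtension A)).map ψ := by
    rintro c ⟨hc1, hc2⟩
    obtain ⟨e, he, rfl⟩ := hcomm hc2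
    exact ⟨e, ⟨(hψ e).symm.trans hc1, he⟩, rfl⟩
  have := Finite.of_surjective _ (ψ.subgroupMap_surjective ((FreeCentralExtension.proj A).ker ⊓
    commutator (FreeCentralExtension A)))
  exact (card_le_of_le hle).trans (Nat.card_subgroup_map_le _ _)

/-! ### Commutators in central extensions -/

theorem finite_iSup_of_le_center {P ι : Type*} [Group P] [Fintype ι] (H : ι → Subgroup P)
    [∀ i, Finite (H i)] (hH : ∀ i, H i ≤ center P) : Finite (⨆ i, H i : Subgroup P) := by
  have hcomm : Pairwise fun i j : ι ↦ ∀ x y : P, x ∈ H i → y ∈ H j → Commute x y :=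
    fun i j _ x y _ hy ↦ mem_center_iff.mp (hH j hy) x
  rw [← noncommPiCoprod_range (hcomm := hcomm)]
  exact Finite.of_surjective _ (MonoidHom.rangeRestrict_surjective _)

theorem card_iSup_le_prod_of_le_center {P ι : Type*} [Group P] [Fintype ι] (H : ι → Subgroup P)
    [∀ i, Finite (H i)] (hH : ∀ i, H i ≤ center P) :
    Nat.card (⨆ i, H i : Subgroup P) ≤ ∏ i, Nat.card (H i) := by
  have hcomm : Pairwise fun i j : ι ↦ ∀ x y : P, x ∈ H i → y ∈ H j → Commute x y :=
    fun i j _ x y _ hy ↦ mem_center_iff.mp (hH j hy) x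
  rw [← noncommPiCoprod_range (hcomm := hcomm), ← Nat.card_pi]
  exact Nat.card_le_card_of_surjective _ (MonoidHom.rangeRestrict_surjective _)

/-- The elements whose commutators with `s` lie in a given central subgroup form a subgroup. -/
def commutatorPreimage {P : Type*} [Group P] (s : P) (L : Subgroup P) (hL : L ≤ center P) :
    Subgroup P where
  carrier := {e | ⁅s, e⁆ ∈ L}
  one_mem' := by simp
  mul_mem' {a b} ha hb := by
    have : ⁅s, a * b⁆ = ⁅s, a⁆ * ⁅s, b⁆ := by
      have h := mem_center_iff.mp (hL hb) a
      calc ⁅s, a * b⁆ = ⁅s, a⁆ * (a * ⁅s, b⁆) * a⁻¹ := by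
            simp only [commutatorElement_def]; group
        _ = _ := by rw [h]; group
    rw [Set.mem_ofPred_eq, this]
    exact mul_mem ha hb
  inv_mem' {a} ha := by
    have : ⁅s, a⁻¹⁆ = ⁅s, a⁆⁻¹ := by
      have h := mem_center_iff.mp (inv_mem (hL ha)) a⁻¹
      calc ⁅s, a⁻¹⁆ = (a⁻¹ * ⁅s, a⁆⁻¹) * a := by simp only [commutatorElement_def]; group
        _ = _ := by rw [h]; group
    rw [Set.mem_ofPred_eq, this]
    exact inv_mem ha

/-- Commutation with `t` as a homomorphism on a subgroup `S` with `[S, P]` central. -/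
def commutatorHom {P : Type*} [Group P] (S : Subgroup P) (hS : ⁅S, ⊤⁆ ≤ center P) (t : P) :
    S →* P where
  toFun s := ⁅(s : P), t⁆
  map_one' := by simp
  map_mul' a b := by
    have h := mem_center_iff.mp (hS (commutator_mem_commutator b.2 (mem_top t))) a
    calc ⁅(a : P) * b, t⁆ = (a * ⁅(b : P), t⁆) * (a : P)⁻¹ * ⁅(a : P), t⁆ := by
          simp only [commutatorElement_def]; group
      _ = ⁅(b : P), t⁆ * ⁅(a : P), t⁆ := by rw [h]; group
      _ = _ := (mem_center_iff.mp (hS (commutator_mem_commutator b.2 (mem_top t))) _).symm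

/-- If `S` is the preimage of a central subgroup `K` in a central extension, then `[S, P]` is
generated by the images of `K` under the homomorphisms `s ↦ [s, t]`, where it suffices that the
elements `t` generate the group together with the centralizer of `S`. -/
theorem card_commutator_comap_le {P G ι : Type*} [Group P] [Group G] [Finite G] [Fintype ι]
    {f : P →* G} (hf : Function.Surjective f) (hker : f.ker ≤ center P) {K : Subgroup G}
    (hK : K ≤ center G) (T : ι → P)
    (hT : closure (Set.range T) ⊔ centralizer (K.comap f : Set P) = ⊤) :
    Nat.card (⁅K.comap f, ⊤⁆ : Subgroup P) ≤ Nat.card K ^ Fintype.card ι := by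
  set S := K.comap f with hS
  have hSc : ⁅S, ⊤⁆ ≤ center P := by
    refine (commutator_le.mpr fun s hs e _ ↦ ?_).trans hker
    rw [MonoidHom.mem_ker, map_commutatorElement, commutatorElement_eq_one_iff_mul_comm]
    exact (mem_center_iff.mp (hK hs) _).symm
  let H : ι → Subgroup P := fun i ↦ (commutatorHom S hSc (T i)).range
  have hHc : ∀ i, H i ≤ center P := by
    rintro i _ ⟨s, rfl⟩
    exact hSc (commutator_mem_commutator s.2 (mem_top _))
  have hsurj : ∀ i, ∃ g : K → H i, Function.Surjective g := by
    intro i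
    have hσ : ∀ k : K, f (Function.surjInv hf k) = k := fun k ↦ Function.surjInv_eq hf _
    refine ⟨fun k ↦ ⟨⁅Function.surjInv hf (k : G), T i⁆,
      ⟨Function.surjInv hf (k : G), by rw [hS, mem_comap, hσ]; exact k.2⟩, rfl⟩, ?_⟩
    rintro ⟨_, ⟨s, hs⟩, rfl⟩
    exact ⟨⟨f s, hs⟩, Subtype.ext (commutatorElement_eq_of_map_eq hker (hσ _) rfl)⟩
  have hfin : ∀ i, Finite (H i) := fun i ↦ Finite.of_surjective _ (hsurj i).choose_spec
  have hLc : ⨆ i, H i ≤ center P := iSup_le hHc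
  have hle : ⁅S, ⊤⁆ ≤ ⨆ i, H i := by
    refine commutator_le.mpr fun s hs e _ ↦ ?_
    have : (⊤ : Subgroup P) ≤ commutatorPreimage s _ hLc := by
      rw [← hT, sup_le_iff, closure_le]
      refine ⟨?_, fun c hc ↦ ?_⟩
      · rintro _ ⟨i, rfl⟩
        exact mem_iSup_of_mem i ⟨⟨s, hs⟩, rfl⟩
      · change ⁅s, c⁆ ∈ ⨆ i, H i
        rw [commutatorElement_eq_one_iff_mul_comm.mpr (mem_centralizer_iff.mp hc s hs)]
        exact one_mem _
    exact this (mem_top e)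
  have : Finite (⨆ i, H i : Subgroup P) := finite_iSup_of_le_center H hHc
  calc Nat.card (⁅S, ⊤⁆ : Subgroup P) ≤ Nat.card (⨆ i, H i : Subgroup P) := card_le_of_le hle
    _ ≤ ∏ i, Nat.card (H i) := card_iSup_le_prod_of_le_center H hHc
    _ ≤ ∏ _i : ι, Nat.card K := Finset.prod_le_prod' fun i _ ↦
        Nat.card_le_card_of_surjective _ (hsurj i).choose_spec
    _ = _ := by simp

/-! ### The effect of a central quotient on the Schur multiplier -/

theorem Nat.card_subgroup_eq_card_ker_inf_mul_card_map {G H : Type*} [Group G] [Group H]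
    (f : G →* H) (K : Subgroup G) :
    Nat.card K = Nat.card (f.ker ⊓ K : Subgroup G) * Nat.card (K.map f) := by
  rw [← relIndex_ker, ← card_mul_index (f.ker.subgroupOf K), ← inf_subgroupOf_right,
    Nat.card_congr (subgroupOfEquivOfLe (inf_le_right : f.ker ⊓ K ≤ K)).toEquiv]
  rw [inf_subgroupOf_right]; rfl

theorem MonoidHom.map_commutator_of_surjective {G A : Type*} [Group G] [Group A] {f : G →* A}
    (hf : Function.Surjective f) : (commutator G).map f = commutator A := by
  rw [commutator_def, commutator_def, map_commutator, map_top_of_surjective _ hf]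

/-- Both factors compute `|S ∩ E'|`, where `E = F / [R, F]` and `S` is the preimage in `E` of the
kernel `K` of `f`: the projection to `G` maps `S ∩ E'` onto `K` with kernel `M(G)`, while
`E / [S, E]` is a central extension of `A`, in which `S ∩ E'` becomes part of an image of `M(A)`. -/
theorem card_schurMultiplier_mul_card_ker_le {G A : Type*} [Group G] [Group A] [Finite G]
    {f : G →* A} (hf : Function.Surjective f) (hder : f.ker ≤ commutator G) :
    Nat.card (SchurMultiplier G) * Nat.card f.ker ≤ Nat.card (SchurMultiplier A) *
      Nat.card (⁅f.ker.comap (FreeCentralExtension.proj G), ⊤⁆ :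
        Subgroup (FreeCentralExtension G)) := by
  set π := FreeCentralExtension.proj G with hπ
  have hπs : Function.Surjective π := FreeCentralExtension.proj_surjective G
  have hπc : π.ker ≤ center _ := FreeCentralExtension.ker_proj_le_center G
  set S := f.ker.comap π with hS
  have hπS : π.ker ≤ S := fun x hx ↦ by
    rw [hS, mem_comap, MonoidHom.mem_ker.mp hx]; exact one_mem _
  set N := ⁅S, (⊤ : Subgroup (FreeCentralExtension G))⁆ with hN
  have hNS : N ≤ S := commutator_le_left _ _
  have hNE : N ≤ commutator _ := commutator_mono le_top le_rfl
  have := Finite.of_surjective f hf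
  let g : FreeCentralExtension G ⧸ N →* A := QuotientGroup.lift N (f.comp π) hNS
  have hgs : Function.Surjective g := fun a ↦ by
    obtain ⟨b, rfl⟩ := hf a
    obtain ⟨e, rfl⟩ := hπs b
    exact ⟨QuotientGroup.mk e, rfl⟩
  have hgc : g.ker ≤ center _ := by
    intro x hx
    rw [mem_center_iff]
    intro y
    obtain ⟨x, rfl⟩ := QuotientGroup.mk'_surjective _ x
    obtain ⟨y, rfl⟩ := QuotientGroup.mk'_surjective _ y
    rw [eq_comm, ← commutatorElement_eq_one_iff_mul_comm, ← map_commutatorElement]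
    exact (QuotientGroup.eq_one_iff _).mpr (commutator_mem_commutator (H₁ := S) hx (mem_top y))
  have h1 := Nat.card_subgroup_eq_card_ker_inf_mul_card_map π (S ⊓ commutator _)
  have h2 := Nat.card_subgroup_eq_card_ker_inf_mul_card_map (QuotientGroup.mk' N)
    (S ⊓ commutator _)
  have h3 : (S ⊓ commutator _).map π = f.ker := by
    refine le_antisymm ?_ fun k hk ↦ ?_
    · rintro _ ⟨s, hs, rfl⟩
      exact hs.1
    · obtain ⟨c, hc, rfl⟩ := (MonoidHom.map_commutator_of_surjective hπs).ge (hder hk)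
      exact ⟨c, ⟨hk, hc⟩, rfl⟩
  rw [← inf_assoc, inf_eq_left.mpr hπS, h3, ← FreeCentralExtension.card_schurMultiplier] at h1
  rw [QuotientGroup.ker_mk', inf_eq_left.mpr (le_inf hNS hNE), h1, mul_comm (Nat.card N)] at h2
  rw [h2]
  refine Nat.mul_le_mul_right _ (le_trans ?_ (card_ker_inf_commutator_le hgs hgc))
  have := finite_commutator_of_ker_le_center hgc
  have : Finite (g.ker ⊓ commutator _ : Subgroup _) :=
    Finite.of_injective _ (inclusion_injective inf_le_right)
  refine card_le_of_le ?_
  rintro _ ⟨s, hs, rfl⟩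
  refine ⟨hs.1, ?_⟩
  rw [← MonoidHom.map_commutator_of_surjective (QuotientGroup.mk'_surjective N)]
  exact mem_map_of_mem _ hs.2

theorem card_schurMultiplier_mul_card_ker_le_pow {G A : Type*} [Group G] [Group A] [Finite G]
    {f : G →* A} (hf : Function.Surjective f) (hcen : f.ker ≤ center G)
    (hder : f.ker ≤ commutator G) :
    Nat.card (SchurMultiplier G) * Nat.card f.ker ≤
      Nat.card (SchurMultiplier A) * Nat.card f.ker ^ Group.rank G := by
  refine (card_schurMultiplier_mul_card_ker_le hf hder).trans (Nat.mul_le_mul_left _ ?_)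
  obtain ⟨X, hX, hXc⟩ := Group.rank_spec G
  have hs := FreeCentralExtension.proj_surjective G
  have hc := FreeCentralExtension.ker_proj_le_center G
  have h := card_commutator_comap_le hs hc hcen
    (fun x : X ↦ Function.surjInv hs (x : G)) (by
      set C := closure (Set.range fun x : X ↦ Function.surjInv hs (x : G)) with hC
      have h1 : C ⊔ (FreeCentralExtension.proj G).ker = ⊤ := by
        rw [← comap_map_eq, hC, MonoidHom.map_closure, ← Set.range_comp]
        have : (FreeCentralExtension.proj G ∘ fun x : X ↦ Function.surjInv hs (x : G)) =
            Subtype.val := funext fun x ↦ Function.surjInv_eq hs _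
        rw [this, Subtype.range_coe, hXc, comap_top]
      exact top_le_iff.mp (h1.ge.trans (sup_le_sup_left
        (hc.trans (center_le_centralizer _)) _)))
  rwa [Fintype.card_coe, hX] at h

/-- A non-trivial normal subgroup `H` of a finite `p`-group meets the center in an element of order
`p`, because the group acts on `H` by conjugation with more than one fixed point. -/
theorem IsPGroup.exists_mem_center_orderOf_eq {p : ℕ} [Fact p.Prime] {G : Type*} [Group G]
    [Finite G] (hG : IsPGroup p G) {H : Subgroup G} [H.Normal] (hH : H ≠ ⊥) :
    ∃ z ∈ H, z ∈ center G ∧ orderOf z = p := by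
  have hdvd : p ∣ Nat.card H := by
    obtain ⟨n, hn⟩ := IsPGroup.iff_card.mp (hG.to_subgroup H)
    rw [hn]
    refine dvd_pow_self _ ?_
    rintro rfl
    exact hH (eq_bot_of_card_eq H (by simpa using hn))
  have h1 : (1 : H) ∈ MulAction.fixedPoints (ConjAct G) H := fun g ↦ by simp
  obtain ⟨b, hb, hb1⟩ := (hG.of_equiv
    ConjAct.toConjAct).exists_fixed_point_of_prime_dvd_card_of_fixed_point H hdvd h1
  have hbc : (b : G) ∈ center G := by
    rw [mem_center_iff]
    intro g
    have := congrArg Subtype.val (hb (ConjAct.toConjAct g))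
    rw [ConjAct.Subgroup.val_conj_smul, ConjAct.toConjAct_smul] at this
    exact mul_inv_eq_iff_eq_mul.mp this
  have hnt : Nontrivial (H ⊓ center G : Subgroup G) := by
    refine ⟨⟨⟨b, b.2, hbc⟩, 1, fun h ↦ hb1 ?_⟩⟩
    exact Subtype.ext (congrArg Subtype.val h).symm
  obtain ⟨n, hn0, hn⟩ := (hG.to_subgroup (H ⊓ center G)).nontrivial_iff_card.mp hnt
  obtain ⟨z, hz⟩ := exists_prime_orderOf_dvd_card' (G := (H ⊓ center G : Subgroup G)) p
    (hn ▸ dvd_pow_self p hn0.ne')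
  exact ⟨z, z.2.1, z.2.2, by rw [← hz, Subgroup.orderOf_coe]⟩

theorem Subgroup.normal_of_le_center {G : Type*} [Group G] {K : Subgroup G} (hK : K ≤ center G) :
    K.Normal :=
  ⟨fun k hk g ↦ by rwa [mem_center_iff.mp (hK hk) g, mul_inv_cancel_right]⟩

/-- The comparison of multipliers along a central kernel, iterated along a central series. -/
theorem IsPGroup.card_schurMultiplier_mul_card_ker_le_pow {p : ℕ} [Fact p.Prime] {G A : Type*}
    [Group G] [Group A] [Finite G] (hG : IsPGroup p G) {f : G →* A} (hf : Function.Surjective f)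
    (hder : f.ker ≤ commutator G) :
    Nat.card (SchurMultiplier G) * Nat.card f.ker ≤
      Nat.card (SchurMultiplier A) * Nat.card f.ker ^ Group.rank G := by
  induction hn : Nat.card f.ker using Nat.strong_induction_on generalizing G with
  | _ n ih =>
    rw [← hn]
    by_cases hbot : f.ker = ⊥
    · exact _root_.card_schurMultiplier_mul_card_ker_le_pow hf (hbot ▸ bot_le) hder
    obtain ⟨z, hz, hzc, hzp⟩ := hG.exists_mem_center_orderOf_eq hbot
    have hKc : zpowers z ≤ center G := (zpowers_le).mpr hzc
    have hKf : zpowers z ≤ f.ker := (zpowers_le).mpr hz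
    have := normal_of_le_center hKc
    let q := QuotientGroup.mk' (zpowers z)
    have hqs : Function.Surjective q := QuotientGroup.mk'_surjective _
    have hqk : q.ker = zpowers z := QuotientGroup.ker_mk' _
    let g : G ⧸ zpowers z →* A := QuotientGroup.lift _ f hKf
    have hgk : g.ker = f.ker.map q := QuotientGroup.ker_lift _ _ _
    have hgs : Function.Surjective g := fun a ↦ by
      obtain ⟨b, rfl⟩ := hf a
      exact ⟨QuotientGroup.mk b, rfl⟩
    have hcard : Nat.card f.ker = p * Nat.card g.ker := by
      rw [Nat.card_subgroup_eq_card_ker_inf_mul_card_map q f.ker, hqk, inf_eq_left.mpr hKf,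
        Nat.card_zpowers, hzp, hgk]
    have hp2 := (Fact.out : p.Prime).two_le
    have hpos : 0 < Nat.card g.ker := Nat.card_pos
    have h1 := _root_.card_schurMultiplier_mul_card_ker_le_pow hqs (hqk.trans_le hKc)
      (hqk.trans_le (hKf.trans hder))
    rw [hqk, Nat.card_zpowers, hzp] at h1
    have h2 := ih (Nat.card g.ker) (by rw [← hn, hcard]; nlinarith)
      (hG.to_quotient (zpowers z)) hgs (by
        rw [hgk, ← MonoidHom.map_commutator_of_surjective hqs]; exact map_mono hder) rfl
    calc Nat.card (SchurMultiplier G) * Nat.card f.ker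
        = (Nat.card (SchurMultiplier G) * p) * Nat.card g.ker := by rw [hcard]; ring
      _ ≤ (Nat.card (SchurMultiplier (G ⧸ zpowers z)) * p ^ Group.rank G) * Nat.card g.ker := by
          gcongr
      _ = (Nat.card (SchurMultiplier (G ⧸ zpowers z)) * Nat.card g.ker) * p ^ Group.rank G := by
          ring
      _ ≤ (Nat.card (SchurMultiplier A) * Nat.card g.ker ^ Group.rank (G ⧸ zpowers z)) *
            p ^ Group.rank G := by gcongr
      _ ≤ (Nat.card (SchurMultiplier A) * Nat.card g.ker ^ Group.rank G) * p ^ Group.rank G := by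
          gcongr
          exact Group.rank_le_of_surjective q hqs
      _ = _ := by rw [hcard]; ring

/-! ### Abelian groups -/

theorem prod_prod_ite_lt_mul {ι : Type*} [Fintype ι] [LinearOrder ι] (o : ι → ℕ) :
    ∏ i, ∏ j, (if i < j then o i * o j else 1) = (∏ i, o i) ^ (Fintype.card ι - 1) := by
  have h : ∀ i j, (if i < j then o i * o j else 1) =
      (if i < j then o i else 1) * (if i < j then o j else 1) := by
    intro i j; split_ifs <;> simp
  simp_rw [h, Finset.prod_mul_distrib]
  rw [Finset.prod_comm (f := fun i j ↦ if i < j then o j else 1), ← Finset.prod_mul_distrib,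
    ← Finset.prod_pow]
  refine Finset.prod_congr rfl fun i _ ↦ ?_
  rw [← Finset.prod_mul_distrib]
  have h' : ∀ j, (if i < j then o i else 1) * (if j < i then o i else 1) =
      if j ∈ Finset.univ.erase i then o i else 1 := by
    intro j
    rcases lt_trichotomy i j with h | h | h
    · simp [h, h.ne', not_lt_of_gt h]
    · simp [h]
    · simp [h, h.ne, not_lt_of_gt h]
  simp_rw [h']
  rw [Finset.prod_ite_mem]
  simp

/-- If `A` is generated by `x i` with `x i ^ o i = 1`, then the derived subgroup of a central
extension of `A` is generated by the commutators of lifts of `x i` and `x j` for `i < j`, whose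
orders divide both `o i` and `o j` and so are at most the geometric mean of `o i` and `o j`. -/
theorem sq_card_schurMultiplier_le_prod_pow {A ι : Type*} [CommGroup A] [Finite A] [Fintype ι]
    [LinearOrder ι] (x : ι → A) (hx : closure (Set.range x) = ⊤) (o : ι → ℕ) (ho : ∀ i, 0 < o i)
    (hxo : ∀ i, x i ^ o i = 1) :
    Nat.card (SchurMultiplier A) ^ 2 ≤ (∏ i, o i) ^ (Fintype.card ι - 1) := by
  set π := FreeCentralExtension.proj A with hπ
  have hs : Function.Surjective π := FreeCentralExtension.proj_surjective A
  have hc : π.ker ≤ center _ := FreeCentralExtension.ker_proj_le_center A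
  have hcc : ∀ a b : FreeCentralExtension A, ⁅a, b⁆ ∈ π.ker := fun a b ↦ by
    rw [MonoidHom.mem_ker, map_commutatorElement, commutatorElement_eq_one_iff_mul_comm, mul_comm]
  have hS : ⁅(⊤ : Subgroup (FreeCentralExtension A)), ⊤⁆ ≤ center _ :=
    (commutator_le.mpr fun a _ b _ ↦ hcc a b).trans hc
  let X : ι → FreeCentralExtension A := fun i ↦ Function.surjInv hs (x i)
  have hX : ∀ i, π (X i) = x i := fun i ↦ Function.surjInv_eq hs _
  have hXT : closure (Set.range X) ⊔ center _ = ⊤ := by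
    refine top_le_iff.mp (le_trans ?_ (sup_le_sup_left hc _))
    rw [← comap_map_eq, MonoidHom.map_closure, ← Set.range_comp]
    rw [show π ∘ X = x from funext hX, hx, comap_top]
  have hpow : ∀ i (b : FreeCentralExtension A), ⁅X i, b⁆ ^ o i = 1 := by
    intro i b
    have h := map_pow (commutatorHom ⊤ hS b) ⟨X i, mem_top _⟩ (o i)
    refine h.symm.trans ?_
    change ⁅X i ^ o i, b⁆ = 1
    rw [commutatorElement_eq_one_iff_mul_comm]
    refine (mem_center_iff.mp (hc ?_) b).symm
    rw [MonoidHom.mem_ker, map_pow, hX, hxo]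
  let c : ι × ι → FreeCentralExtension A := fun q ↦ if q.1 < q.2 then ⁅X q.1, X q.2⁆ else 1
  have hcz : ∀ q, c q ∈ center _ := by
    intro q
    by_cases h : q.1 < q.2
    · simpa [c, h] using hc (hcc (X q.1) (X q.2))
    · simp [c, h]
  have hcfin : ∀ q, IsOfFinOrder (c q) := by
    intro q
    by_cases h : q.1 < q.2
    · simpa [c, h] using isOfFinOrder_iff_pow_eq_one.mpr ⟨_, ho q.1, hpow q.1 (X q.2)⟩
    · simp [c, h]
  have hord : ∀ q, orderOf (c q) ^ 2 ≤ if q.1 < q.2 then o q.1 * o q.2 else 1 := by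
    intro q
    by_cases h : q.1 < q.2
    · simp only [c, h, if_true, sq]
      refine Nat.mul_le_mul (orderOf_le_of_pow_eq_one (ho _) (hpow _ _))
        (orderOf_le_of_pow_eq_one (ho _) ?_)
      rw [← commutatorElement_inv, inv_pow, hpow, inv_one]
    · simp [c, h]
  let H : ι × ι → Subgroup (FreeCentralExtension A) := fun q ↦ zpowers (c q)
  have hHc : ∀ q, H q ≤ center _ := fun q ↦ (zpowers_le).mpr (hcz q)
  have hHfin : ∀ q, Finite (H q) := fun q ↦ finite_zpowers.mpr (hcfin q)
  have hLc : ⨆ q, H q ≤ center _ := iSup_le hHc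
  have hXX : ∀ i j, ⁅X i, X j⁆ ∈ ⨆ q, H q := by
    have key : ∀ i j, i < j → ⁅X i, X j⁆ ∈ ⨆ q, H q := fun i j h ↦
      mem_iSup_of_mem (i, j) (by simp [H, c, h])
    intro i j
    rcases lt_trichotomy i j with h | rfl | h
    · exact key i j h
    · simp
    · rw [← commutatorElement_inv]
      exact inv_mem (key j i h)
  have hle1 : ∀ i b, ⁅X i, b⁆ ∈ ⨆ q, H q := by
    intro i b
    have : (⊤ : Subgroup _) ≤ commutatorPreimage (X i) _ hLc := by
      rw [← hXT, sup_le_iff, closure_le]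
      refine ⟨?_, fun z hz ↦ ?_⟩
      · rintro _ ⟨j, rfl⟩
        exact hXX i j
      · change ⁅X i, z⁆ ∈ ⨆ q, H q
        rw [commutatorElement_eq_one_iff_mul_comm.mpr (mem_center_iff.mp hz _)]
        exact one_mem _
    exact this (mem_top b)
  have hle : commutator (FreeCentralExtension A) ≤ ⨆ q, H q := by
    refine commutator_le.mpr fun a _ b _ ↦ ?_
    have : (⊤ : Subgroup _) ≤ commutatorPreimage b _ hLc := by
      rw [← hXT, sup_le_iff, closure_le]
      refine ⟨?_, fun z hz ↦ ?_⟩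
      · rintro _ ⟨j, rfl⟩
        change ⁅b, X j⁆ ∈ ⨆ q, H q
        rw [← commutatorElement_inv]
        exact inv_mem (hle1 j b)
      · change ⁅b, z⁆ ∈ ⨆ q, H q
        rw [commutatorElement_eq_one_iff_mul_comm.mpr (mem_center_iff.mp hz _)]
        exact one_mem _
    rw [← commutatorElement_inv]
    exact inv_mem (this (mem_top a))
  have : Finite (⨆ q, H q : Subgroup _) := finite_iSup_of_le_center H hHc
  calc Nat.card (SchurMultiplier A) ^ 2 ≤ Nat.card (⨆ q, H q : Subgroup _) ^ 2 := by
        rw [FreeCentralExtension.card_schurMultiplier]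
        exact Nat.pow_le_pow_left (card_le_of_le (inf_le_right.trans hle)) 2
    _ ≤ (∏ q, Nat.card (H q)) ^ 2 :=
        Nat.pow_le_pow_left (card_iSup_le_prod_of_le_center H hHc) 2
    _ = ∏ q, orderOf (c q) ^ 2 := by
        rw [← Finset.prod_pow]
        exact Finset.prod_congr rfl fun q _ ↦ by rw [Nat.card_zpowers]
    _ ≤ ∏ q : ι × ι, if q.1 < q.2 then o q.1 * o q.2 else 1 :=
        Finset.prod_le_prod' fun q _ ↦ hord q
    _ = _ := by rw [Fintype.prod_prod_type, prod_prod_ite_lt_mul]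

theorem card_le_rank_of_surjective {p : ℕ} [Fact p.Prime] {A ι : Type*} [Group A] [Finite A]
    [Fintype ι] (φ : A →* Multiplicative (ι → ZMod p)) (hφ : Function.Surjective φ) :
    Fintype.card ι ≤ Group.rank A := by
  classical
  obtain ⟨X, hX, hXc⟩ := Group.rank_spec A
  have hspan : Submodule.span (ZMod p) ((X.image fun a ↦ (φ a).toAdd : Finset _) :
      Set (ι → ZMod p)) = ⊤ := by
    refine top_le_iff.mp fun v _ ↦ ?_
    obtain ⟨a, ha⟩ := hφ (Multiplicative.ofAdd v)
    have : ∀ a ∈ closure (X : Set A), (φ a).toAdd ∈ Submodule.span (ZMod p)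
        ((X.image fun a ↦ (φ a).toAdd : Finset _) : Set (ι → ZMod p)) := by
      intro a ha
      induction ha using closure_induction with
      | mem a ha => exact Submodule.subset_span (Finset.mem_image_of_mem _ ha)
      | one => simp
      | mul a b _ _ h1 h2 => rw [map_mul, toAdd_mul]; exact add_mem h1 h2
      | inv a _ h => rw [map_inv, toAdd_inv]; exact neg_mem h
    have h := this a (hXc ▸ mem_top a)
    rwa [ha] at h
  have h := finrank_span_finset_le_card (R := ZMod p) (X.image fun a ↦ (φ a).toAdd)
  rw [Set.finrank, hspan, finrank_top, Module.finrank_fintype_fun_eq_card] at h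
  exact h.trans (Finset.card_image_le.trans hX.le)

/-- The bound for abelian groups: in a decomposition into non-trivial cyclic `p`-groups the number
of factors is at most the rank, as `A` maps onto the product of one copy of `ZMod p` for each. -/
theorem IsPGroup.sq_card_schurMultiplier_le {p : ℕ} [Fact p.Prime] {A : Type*} [CommGroup A]
    [Finite A] (hA : IsPGroup p A) :
    Nat.card (SchurMultiplier A) ^ 2 ≤ Nat.card A ^ (Group.rank A - 1) := by
  classical
  obtain ⟨ι, _, n, hn, ⟨e⟩⟩ := CommGroup.equiv_prod_multiplicative_zmod_of_finite A
  let : LinearOrder ι := LinearOrder.lift' (Fintype.equivFin ι) (Fintype.equivFin ι).injective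
  have hcard : Nat.card A = ∏ i, n i := by
    rw [Nat.card_congr e.toEquiv, Nat.card_pi]
    exact Finset.prod_congr rfl fun i _ ↦
      (Nat.card_congr Multiplicative.toAdd).trans (Nat.card_zmod _)
  have hp : ∀ i, p ∣ n i := by
    intro i
    obtain ⟨k, hk⟩ := IsPGroup.iff_card.mp hA
    have h : n i ∣ p ^ k := by
      rw [← hk, hcard]; exact Finset.dvd_prod_of_mem _ (Finset.mem_univ i)
    obtain ⟨m, -, hm⟩ := (Nat.dvd_prime_pow Fact.out).mp h
    rw [hm]
    refine dvd_pow_self _ ?_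
    rintro rfl
    exact (hn i).ne' (by simpa using hm)
  have hrank : Fintype.card ι ≤ Group.rank A := by
    let ψ : (∀ i, Multiplicative (ZMod (n i))) →* Multiplicative (ι → ZMod p) :=
      { toFun := fun a ↦ Multiplicative.ofAdd fun i ↦
          ZMod.castHom (hp i) (ZMod p) (Multiplicative.toAdd (a i))
        map_one' := by
          refine congrArg Multiplicative.ofAdd (funext fun i ↦ ?_)
          exact map_zero _
        map_mul' := fun a b ↦ by
          refine congrArg Multiplicative.ofAdd (funext fun i ↦ ?_)
          exact map_add _ _ _ }
    refine card_le_rank_of_surjective (ψ.comp e.toMonoidHom) ?_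
    have hψ : Function.Surjective ψ := fun v ↦ ?_
    · exact hψ.comp e.surjective
    choose a ha using fun i ↦ ZMod.castHom_surjective (hp i) (Multiplicative.toAdd v i)
    exact ⟨fun i ↦ Multiplicative.ofAdd (a i), congrArg Multiplicative.ofAdd (funext ha)⟩
  let y : ι → ∀ i, Multiplicative (ZMod (n i)) := fun i ↦
    Pi.mulSingle i (Multiplicative.ofAdd 1)
  have hy : Subgroup.closure (Set.range y) = ⊤ := by
    refine top_le_iff.mp fun a _ ↦ ?_
    rw [← Finset.univ_prod_mulSingle a]
    refine prod_mem fun i _ ↦ ?_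
    have : a i = Multiplicative.ofAdd (1 : ZMod (n i)) ^ ((a i).toAdd.val) := by
      have : NeZero (n i) := ⟨by have := hn i; omega⟩
      rw [← ofAdd_nsmul, nsmul_one, ZMod.natCast_zmod_val, ofAdd_toAdd]
    rw [this, Pi.mulSingle_pow]
    exact pow_mem (Subgroup.subset_closure (Set.mem_range_self i)) _
  rw [hcard]
  refine (sq_card_schurMultiplier_le_prod_pow (fun i ↦ e.symm (y i)) ?_ n
    (fun i ↦ zero_lt_one.trans (hn i)) fun i ↦ ?_).trans
      (Nat.pow_le_pow_right ?_ (Nat.sub_le_sub_right hrank 1))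
  · have := MonoidHom.map_closure e.symm.toMonoidHom (Set.range y)
    rw [hy, map_top_of_surjective _ e.symm.surjective, ← Set.range_comp] at this
    exact this.symm
  · rw [← map_pow, ← Pi.mulSingle_pow, ← ofAdd_nsmul]
    simp
  · exact Finset.prod_pos fun i _ ↦ zero_lt_one.trans (hn i)

/-! ### The upper bound for non-abelian `p`-groups -/

/-- If `G'` is central and generated by a commutator `[X, Y]`, then modulo powers of `X` and `Y`
every element of `G` commutes with `X` and `Y`. -/
theorem exists_eq_mul_zpow_mul_zpow {G : Type*} [Group G] (hcen : commutator G ≤ center G)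
    {X Y : G} (hXY : commutator G = zpowers ⁅X, Y⁆) (Z : G) :
    ∃ (W : G) (k l : ℤ), Z = W * X ^ k * Y ^ l ∧ Commute W X ∧ Commute W Y := by
  have hmem : ∀ t : G, ⁅Z, t⁆ ∈ zpowers ⁅X, Y⁆ := fun t ↦
    hXY.le (commutator_mem_commutator (mem_top Z) (mem_top t))
  obtain ⟨m, hm⟩ := mem_zpowers_iff.mp (hmem X)
  obtain ⟨l, hl⟩ := mem_zpowers_iff.mp (hmem Y)
  let h : G → (⊤ : Subgroup G) →* G := commutatorHom ⊤ hcen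
  have hh : ∀ t a : G, h t ⟨a, mem_top a⟩ = ⁅a, t⁆ := fun _ _ ↦ rfl
  have hW : ∀ t : G, ⁅Z * Y ^ m * X ^ (-l), t⁆ = ⁅Z, t⁆ * ⁅Y, t⁆ ^ m * ⁅X, t⁆ ^ (-l) := by
    intro t
    rw [← hh, ← hh, ← hh, ← hh, ← map_zpow, ← map_zpow, ← map_mul, ← map_mul]
    rfl
  refine ⟨Z * Y ^ m * X ^ (-l), l, -m, by group, ?_, ?_⟩
  · rw [commute_iff_eq, ← commutatorElement_eq_one_iff_mul_comm, hW, ← hm,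
      ← commutatorElement_inv X Y, inv_zpow, mul_inv_cancel, one_mul, commutatorElement_self,
      one_zpow]
  · rw [commute_iff_eq, ← commutatorElement_eq_one_iff_mul_comm, hW, ← hl]
    simp

/-- When `G'` is cyclic of prime order, generated by `[X, Y]`, only the commutators of the lift
of `[X, Y]` with the lifts of `X` and `Y` contribute to the kernel of `M(G) → M(G/G')`. -/
theorem card_commutator_comap_commutator_le {G : Type*} [Group G] [Finite G] {p : ℕ}
    [Fact p.Prime] (hcen : commutator G ≤ center G) (hcard : Nat.card (commutator G) = p) :
    Nat.card (⁅(commutator G).comap (FreeCentralExtension.proj G), ⊤⁆ :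
      Subgroup (FreeCentralExtension G)) ≤ p ^ 2 := by
  set π := FreeCentralExtension.proj G with hπ
  have hs : Function.Surjective π := FreeCentralExtension.proj_surjective G
  have hc : π.ker ≤ center _ := FreeCentralExtension.ker_proj_le_center G
  obtain ⟨x, y, hxy⟩ : ∃ x y, ⁅π x, π y⁆ ≠ 1 := by
    by_contra! h
    have : commutator G = ⊥ := by
      refine le_bot_iff.mp (commutator_le.mpr fun a _ b _ ↦ ?_)
      obtain ⟨a, rfl⟩ := hs a
      obtain ⟨b, rfl⟩ := hs b
      exact h a b
    rw [this, card_bot] at hcard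
    exact (Fact.out : p.Prime).one_lt.ne hcard
  have hmem : ⁅π x, π y⁆ ∈ commutator G := commutator_mem_commutator (mem_top _) (mem_top _)
  have hgen : commutator G = zpowers ⁅π x, π y⁆ := by
    refine le_antisymm (fun c hc ↦ ?_) ((zpowers_le).mpr hmem)
    obtain ⟨k, hk⟩ := mem_zpowers_iff.mp (mem_zpowers_of_prime_card hcard
      (g := (⟨_, hmem⟩ : commutator G)) (g' := ⟨c, hc⟩)
      fun h ↦ hxy (congrArg Subtype.val h))
    exact mem_zpowers_iff.mpr ⟨k, congrArg Subtype.val hk⟩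
  have h := card_commutator_comap_le hs hc hcen ![x, y] (by
    refine top_le_iff.mp fun z _ ↦ ?_
    obtain ⟨W, k, l, hz, hWx, hWy⟩ := exists_eq_mul_zpow_mul_zpow hcen hgen (π z)
    set C := closure (Set.range ![x, y]) with hC
    have hx : x ∈ C := subset_closure ⟨0, rfl⟩
    have hy : y ∈ C := subset_closure ⟨1, rfl⟩
    set w := z * y ^ (-l) * x ^ (-k) with hw
    have hπw : π w = W := by
      rw [hw, map_mul, map_mul, map_zpow, map_zpow, hz]; group
    have hwc : w ∈ centralizer (((commutator G).comap π : Subgroup _) :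
        Set (FreeCentralExtension G)) := by
      -- Conjugation by `w` changes `x` and `y` by central factors only, so it fixes `[x, y]`.
      have hfix : w * ⁅x, y⁆ * w⁻¹ = ⁅x, y⁆ := by
        rw [conjugate_commutatorElement]
        refine commutatorElement_eq_of_map_eq hc ?_ ?_
        · rw [map_mul, map_mul, map_inv, hπw, hWx.eq, mul_inv_cancel_right]
        · rw [map_mul, map_mul, map_inv, hπw, hWy.eq, mul_inv_cancel_right]
      have hcomm : Commute ⁅x, y⁆ w := (mul_inv_eq_iff_eq_mul.mp hfix).symm
      rw [mem_centralizer_iff]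
      intro s hs'
      obtain ⟨j, hj⟩ := mem_zpowers_iff.mp (hgen.le hs')
      rw [← commutatorElement_eq_one_iff_mul_comm,
        commutatorElement_eq_of_map_eq hc (a' := ⁅x, y⁆ ^ j) (b' := w)
          (by rw [map_zpow, map_commutatorElement, hj]) rfl,
        commutatorElement_eq_one_iff_mul_comm]
      exact hcomm.zpow_left j
    have hzw : z = w * x ^ k * y ^ l := by rw [hw]; group
    rw [hzw]
    exact mul_mem (mul_mem (mem_sup_right hwc) (mem_sup_left (zpow_mem hx k)))
      (mem_sup_left (zpow_mem hy l)))
  rwa [hcard, Fintype.card_fin] at h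

theorem Group.one_le_rank (G : Type*) [Group G] [Group.FG G] [Nontrivial G] :
    1 ≤ Group.rank G := by
  by_contra! h
  obtain ⟨X, hX, hXc⟩ := Group.rank_spec G
  rw [Nat.lt_one_iff.mp h, Finset.card_eq_zero] at hX
  rw [hX, Finset.coe_empty, Subgroup.closure_empty] at hXc
  exact bot_ne_top hXc

/-- The upper bound for the Schur multiplier of a non-abelian `p`-group, by induction on the order
of `G'`. The induction starts with `|G'| = p`, where the abelian bound for `G / G'` is lost
by a factor `p` only, and proceeds by quotients by central subgroups of order `p` in `G'`. -/
theorem IsPGroup.sq_card_schurMultiplier_le_of_card_commutator {p : ℕ} [Fact p.Prime] {G : Type*}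
    [Group G] [Finite G] (hG : IsPGroup p G) {n k : ℕ} (hn : Nat.card G = p ^ (n + 1))
    (hk : Nat.card (commutator G) = p ^ (k + 1)) :
    Nat.card (SchurMultiplier G) ^ 2 ≤ p ^ ((Group.rank G - 1) * (n + k) + 2) := by
  have hp : p.Prime := Fact.out
  induction k generalizing G n with
  | zero =>
    rw [zero_add, pow_one] at hk
    have hne : commutator G ≠ ⊥ := by
      intro h
      rw [h, card_bot] at hk
      exact hp.one_lt.ne hk
    obtain ⟨z, hz, hzc, hzp⟩ := hG.exists_mem_center_orderOf_eq hne
    have hcen : commutator G ≤ center G := by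
      rw [← eq_of_le_of_card_ge ((zpowers_le).mpr hz) (by rw [Nat.card_zpowers, hzp, hk])]
      exact (zpowers_le).mpr hzc
    have hs : Function.Surjective (Abelianization.of (G := G)) := QuotientGroup.mk'_surjective _
    have hker : (Abelianization.of (G := G)).ker = commutator G := QuotientGroup.ker_mk' _
    have h1 := card_schurMultiplier_mul_card_ker_le hs hker.le
    rw [hker, hk] at h1
    have h2 := (h1.trans (Nat.mul_le_mul_left _
      (card_commutator_comap_commutator_le hcen hk)))
    rw [sq, ← mul_assoc] at h2
    have h3 := Nat.le_of_mul_le_mul_right h2 hp.pos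
    have hA : Nat.card (Abelianization G) = p ^ n := by
      have h := card_eq_card_quotient_mul_card_subgroup (commutator G)
      rw [hn, hk, pow_succ] at h
      exact (Nat.eq_of_mul_eq_mul_right hp.pos h).symm
    have h4 := (hG.of_surjective _ hs).sq_card_schurMultiplier_le
    rw [hA, ← pow_mul, mul_comm] at h4
    calc Nat.card (SchurMultiplier G) ^ 2
        ≤ (Nat.card (SchurMultiplier (Abelianization G)) * p) ^ 2 := Nat.pow_le_pow_left h3 2
      _ = Nat.card (SchurMultiplier (Abelianization G)) ^ 2 * p ^ 2 := mul_pow _ _ _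
      _ ≤ p ^ ((Group.rank (Abelianization G) - 1) * n) * p ^ 2 := Nat.mul_le_mul_right _ h4
      _ ≤ p ^ ((Group.rank G - 1) * n) * p ^ 2 := by
          gcongr
          · exact hp.one_le
          · exact Group.rank_le_of_surjective _ hs
      _ = _ := by rw [← pow_add, add_zero]
  | succ k ih =>
    have hne : commutator G ≠ ⊥ := by
      intro h
      rw [h, card_bot] at hk
      exact (Nat.one_lt_pow (by omega) hp.one_lt).ne hk
    obtain ⟨z, hz, hzc, hzp⟩ := hG.exists_mem_center_orderOf_eq hne
    have hKc : zpowers z ≤ center G := (zpowers_le).mpr hzc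
    have hKd : zpowers z ≤ commutator G := (zpowers_le).mpr hz
    have := normal_of_le_center hKc
    set q := QuotientGroup.mk' (zpowers z) with hq
    have hqs : Function.Surjective q := QuotientGroup.mk'_surjective _
    have hqk : q.ker = zpowers z := QuotientGroup.ker_mk' _
    have hQ : Nat.card (G ⧸ zpowers z) = p ^ n := by
      have h := card_eq_card_quotient_mul_card_subgroup (zpowers z)
      rw [hn, Nat.card_zpowers, hzp, pow_succ] at h
      exact (Nat.eq_of_mul_eq_mul_right hp.pos h).symm
    have hQ' : Nat.card (commutator (G ⧸ zpowers z)) = p ^ (k + 1) := by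
      have h := Nat.card_subgroup_eq_card_ker_inf_mul_card_map q (commutator G)
      rw [hqk, inf_eq_left.mpr hKd, MonoidHom.map_commutator_of_surjective hqs, hk,
        Nat.card_zpowers, hzp, pow_succ'] at h
      exact (Nat.eq_of_mul_eq_mul_left hp.pos h).symm
    obtain ⟨n, rfl⟩ : ∃ m, n = m + 1 := by
      refine Nat.exists_eq_succ_of_ne_zero ?_
      rintro rfl
      have h := card_le_card_group (commutator (G ⧸ zpowers z))
      rw [hQ, hQ'] at h
      exact absurd ((Nat.pow_le_pow_iff_right hp.one_lt).mp h) (by omega)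
    have hnt : Nontrivial G := by
      rw [← Finite.one_lt_card_iff_nontrivial, hn]
      exact Nat.one_lt_pow (by omega) hp.one_lt
    obtain ⟨r, hr⟩ := Nat.exists_eq_add_of_le' (Group.one_le_rank G)
    have hr' : Group.rank (G ⧸ zpowers z) - 1 ≤ r := by
      have := Group.rank_le_of_surjective q hqs
      omega
    have h1 := _root_.card_schurMultiplier_mul_card_ker_le_pow hqs (hqk.trans_le hKc)
      (hqk.trans_le hKd)
    rw [hqk, Nat.card_zpowers, hzp, hr, pow_succ, ← mul_assoc] at h1
    have h2 := Nat.le_of_mul_le_mul_right h1 hp.pos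
    have h3 := ih (hG.to_quotient (zpowers z)) hQ hQ'
    rw [hr, Nat.add_sub_cancel]
    calc Nat.card (SchurMultiplier G) ^ 2
        ≤ (Nat.card (SchurMultiplier (G ⧸ zpowers z)) * p ^ r) ^ 2 := Nat.pow_le_pow_left h2 2
      _ = Nat.card (SchurMultiplier (G ⧸ zpowers z)) ^ 2 * p ^ (2 * r) := by
          rw [mul_pow, ← pow_mul, mul_comm r]
      _ ≤ p ^ ((Group.rank (G ⧸ zpowers z) - 1) * (n + k) + 2) * p ^ (2 * r) :=
          Nat.mul_le_mul_right _ h3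
      _ ≤ p ^ (r * (n + k) + 2) * p ^ (2 * r) := by
          gcongr
          exact hp.one_le
      _ = _ := by rw [← pow_add]; ring_nf

/-! ### Quotients of groups attaining the bound -/

/-- Attaining the bound passes to every non-abelian quotient `A` of `G` by a subgroup of `G'`. With
the rank of `G` in place of the rank of `A`, the bound for `A` is a lower bound for `|M(A)|`; as
`A` has at most the rank of `G`, the upper bound for `|M(A)|` forces equality. -/
theorem AttainsBound.of_surjective {p : ℕ} [Fact p.Prime] {G A : Type*} [Group G] [Group A]
    [Finite G] [Finite A] (hG : IsPGroup p G) (hbound : AttainsBound p G) {f : G →* A}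
    (hf : Function.Surjective f) (hder : f.ker ≤ commutator G) (hne : commutator A ≠ ⊥) :
    AttainsBound p A := by
  have hp : p.Prime := Fact.out
  have hA : IsPGroup p A := hG.of_surjective f hf
  obtain ⟨n, k, hn, hk, hM⟩ := hbound
  obtain ⟨m, hm⟩ := IsPGroup.iff_card.mp (hG.to_subgroup f.ker)
  obtain ⟨a, ha⟩ := IsPGroup.iff_card.mp hA
  obtain ⟨b, hb⟩ := IsPGroup.iff_card.mp (hA.to_subgroup (commutator A))
  refine ⟨a, b, ha, hb, ?_⟩
  have hna : n = m + a := by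
    have h := Nat.card_subgroup_eq_card_ker_inf_mul_card_map f ⊤
    rw [inf_top_eq, map_top_of_surjective f hf, card_top, card_top, hn, hm, ha, ← pow_add] at h
    exact Nat.pow_right_injective hp.two_le h
  have hkb : k = m + b := by
    have h := Nat.card_subgroup_eq_card_ker_inf_mul_card_map f (commutator G)
    rw [inf_eq_left.mpr hder, MonoidHom.map_commutator_of_surjective hf, hk, hm, hb,
      ← pow_add] at h
    exact Nat.pow_right_injective hp.two_le h
  obtain ⟨b, rfl⟩ : ∃ c, b = c + 1 := by
    refine Nat.exists_eq_succ_of_ne_zero ?_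
    rintro rfl
    exact hne (eq_bot_of_card_eq _ (by simpa using hb))
  obtain ⟨a, rfl⟩ : ∃ c, a = c + 1 := by
    refine Nat.exists_eq_succ_of_ne_zero ?_
    rintro rfl
    have h := card_le_card_group (commutator A)
    rw [ha, hb] at h
    exact absurd ((Nat.pow_le_pow_iff_right hp.one_lt).mp h) (by omega)
  have hnt : Nontrivial A := by
    rw [← Finite.one_lt_card_iff_nontrivial, ha]
    exact Nat.one_lt_pow (by omega) hp.one_lt
  have hr1 := Group.one_le_rank A
  have hr2 := Group.rank_le_of_surjective f hf
  have hupper := hA.sq_card_schurMultiplier_le_of_card_commutator ha hb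
  have hlower := hG.card_schurMultiplier_mul_card_ker_le_pow hf hder
  set r := Group.rank A
  set d := Group.rank G
  have hp0 : (0 : ℝ) < p := by exact_mod_cast hp.pos
  have hp1 : (1 : ℝ) ≤ p := by exact_mod_cast hp.one_le
  have hr1' : (1 : ℝ) ≤ r := by exact_mod_cast hr1
  have hr2' : (r : ℝ) ≤ d := by exact_mod_cast hr2
  apply le_antisymm
  · refine le_of_sq_le_sq ?_ (Real.rpow_nonneg hp0.le _)
    rw [← Real.rpow_natCast _ 2, ← Real.rpow_natCast _ 2, ← Real.rpow_mul hp0.le,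
      Real.rpow_natCast]
    have h : (Nat.card (SchurMultiplier A) : ℝ) ^ 2 ≤ (p : ℝ) ^ ((r - 1) * (a + b) + 2) := by
      exact_mod_cast hupper
    refine h.trans_eq ?_
    rw [← Real.rpow_natCast]
    congr 1
    push_cast [Nat.cast_sub hr1]
    ring
  · have h : (Nat.card (SchurMultiplier G) : ℝ) * (p : ℝ) ^ m ≤
        Nat.card (SchurMultiplier A) * ((p : ℝ) ^ m) ^ d := by
      rw [hm] at hlower
      exact_mod_cast hlower
    rw [hM, hna, hkb, ← pow_mul, ← Real.rpow_natCast, ← Real.rpow_natCast _ (m * d),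
      ← Real.rpow_add hp0] at h
    have h' := mul_le_mul_of_nonneg_right h (Real.rpow_nonneg hp0.le (-((m * d : ℕ) : ℝ)))
    rw [mul_assoc (Nat.card (SchurMultiplier A) : ℝ), ← Real.rpow_add hp0,
      ← Real.rpow_add hp0, add_neg_cancel, Real.rpow_zero,
      mul_one] at h'
    refine le_trans (Real.rpow_le_rpow_of_exponent_le hp1 ?_) h'
    push_cast
    have ha0 : (0 : ℝ) ≤ a := a.cast_nonneg
    have hb0 : (0 : ℝ) ≤ b := b.cast_nonneg
    nlinarith [mul_nonneg (sub_nonneg.mpr hr2') (add_nonneg ha0 hb0)]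

end

theorem mainTheorem8 (p : ℕ) (hp : p.Prime) (G : Type*) [Group G] [Finite G]
    (hG : IsPGroup p G) (t : ℕ) (ht : 3 ≤ t) (hclass : Group.nilpotencyClass G = t)
    (hbound : AttainsBound p G) :
    ∀ i : ℕ, 3 ≤ i → i ≤ t → AttainsBound p (G ⧸ gammaSubgroup G i) := by
  intro i hi _
  have : Fact p.Prime := ⟨hp⟩
  have : Group.IsNilpotent G := hG.isNilpotent
  have hanti := Subgroup.lowerCentralSeries_antitone (⊤ : Subgroup G)
  have hker : (QuotientGroup.mk' (gammaSubgroup G i)).ker = gammaSubgroup G i :=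
    QuotientGroup.ker_mk' _
  have hs := QuotientGroup.mk'_surjective (gammaSubgroup G i)
  refine hbound.of_surjective hG hs ?_ fun h ↦ ?_
  · rw [hker, ← Subgroup.top_lowerCentralSeries_one]
    exact hanti (by omega)
  -- If `G / γ_i(G)` is abelian, then `γ_2(G) ≤ γ_i(G) ≤ γ_3(G)`, so the lower central series is
  -- constant from `γ_2(G)` on and `G` is abelian.
  · rw [← MonoidHom.map_commutator_of_surjective hs, Subgroup.map_eq_bot_iff, hker,
      ← Subgroup.top_lowerCentralSeries_one] at h
    have h12 : (⊤ : Subgroup G).lowerCentralSeries 1 ≤ (⊤ : Subgroup G).lowerCentralSeries 2 :=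
      h.trans (hanti (by omega))
    have hconst : ∀ j, (⊤ : Subgroup G).lowerCentralSeries 1 ≤
        (⊤ : Subgroup G).lowerCentralSeries (j + 1) := by
      intro j
      induction j with
      | zero => exact le_rfl
      | succ j ih =>
        refine h12.trans ?_
        rw [Subgroup.lowerCentralSeries_succ, Subgroup.lowerCentralSeries_succ _ (j + 1)]
        exact Subgroup.commutator_mono ih le_rfl
    have hbot : (⊤ : Subgroup G).lowerCentralSeries 1 = ⊥ := by
      refine le_bot_iff.mp ((hconst t).trans ?_)
      rw [← hclass, ← Subgroup.lowerCentralSeries_nilpotencyClass (G := G)]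
      exact hanti (Nat.le_succ _)
    have := Subgroup.lowerCentralSeries_eq_bot_iff_nilpotencyClass_le.mp hbot
    omega
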